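/- A 2D-QAC circuit $C$ of width $w$ and depth $d$ acts on qubits arranged in a grid with $w$ rows of some length $m$. It has the form $C = L_d M_d \cdots L_1 M_1 L_0$, where each $L_k$ is a tensor product of arbitrary single-qubit unitaries, one on each qubit, and each $M_k$ is a layer of multi-qubit $\mathrm{CZ}$ gates with pairwise disjoint supports. The support of a gate is the set of qubits on which it acts; a $\mathrm{CZ}$ gate maps $|1\cdots1\rangle$ on its support to $-|1\cdots1\rangle$ and fixes all other basis states; and every support is an interval of consecutive qubits in one row or one column. A set $I$ of $n$ of the qubits carries the input $x \in \{0,1\}^I$, in the basis state $|x\rangle$; the other qubits are ancillas, in an arbitrary fixed pure (unit) state $|a\rangle$ independent of $x$. Running $C$ on $|x\rangle \otimes |a\rangle$ and measuring a fixed output qubit in the computational basis gives a random bit $g_C(x)$. The forward light-cone of a qubit $i$ in a circuit of depth $t$ is the set of all qubits $j$ for which there is a path $i = i_0, i_1, \ldots, i_t = j$ such that for each layer $k = 1, \dots, t$ the qubits $i_{k-1}, i_k$ either coincide or lie in the support of the same $\mathrm{CZ}$ gate of layer $M_k$. The weight of a $\mathrm{CZ}$ gate of layer $M_k$ in $C$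 is the number of input qubits $i \in I$ whose forward light-cone in the circuit $L_{k-1} M_{k-1} \cdots M_1 L_0$ formed by the preceding layers meets the support of the gate. **Lemma.** Let $n, w, d \ge 1$ and $s \ge 3$ be integers, and let $C$ be a depth-$d$ width-$w$ 2D-QAC circuit with input qubits $I$, $|I| = n$. If every $\mathrm{CZ}$ gate of $C$ has weight at most $s$ and $$(2s)^w \cdot (2w+1)^{w(w-1)/2} < n^{1/d},$$ then $$\Pr_{x, C}\big[g_C(x) = \textstyle\bigoplus_{i \in I} x_i\big] = \frac12,$$ where $x$ is uniform in $\{0,1\}^I$ and the probability is over $x$ and the measurement. -/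

import Mathlib

/-- One layer of multi-qubit `CZ` gates on the qubits `Q`. A gate is given by its support, a set of
at least two qubits, and distinct gates of the layer have disjoint supports. -/
structure CZLayer (Q : Type*) where
  gates : Finset (Finset Q)
  two_le_card : ∀ T ∈ gates, 2 ≤ T.card
  pairwiseDisjoint : (gates : Set (Finset Q)).PairwiseDisjoint id

/-- A depth-`d` QAC circuit `L_d M_d ⋯ L_1 M_1 L_0` on the qubits `Q`: the layers
`L_0, …, L_d` apply a single-qubit unitary to every qubit, and the `d` layers between them consist
of multi-qubit `CZ` gates with disjoint supports. The `CZ` layer `M_{k+1}` is `cz k`. -/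
structure QACCircuit (Q : Type*) (d : ℕ) where
  single : Fin (d + 1) → Q → Matrix.unitaryGroup Bool ℂ
  cz : Fin d → CZLayer Q

/-- The matrix, in the computational basis, of the tensor product of the single-qubit unitaries
`U q`. -/
def singleLayerMatrix {Q : Type*} [Fintype Q] (U : Q → Matrix.unitaryGroup Bool ℂ) :
    Matrix (Q → Bool) (Q → Bool) ℂ :=
  Matrix.of fun x y => ∏ q, (U q : Matrix Bool Bool ℂ) (x q) (y q)

/-- The phase that the `CZ` gate with support `T` gives to the basis state `|x⟩`:
`-1` if all qubits of `T` are `1`, and `1` otherwise. -/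
def czPhase {Q : Type*} (T : Finset Q) (x : Q → Bool) : ℂ :=
  if ∀ q ∈ T, x q = true then -1 else 1

/-- The matrix of the `CZ` gate with support `T` (acting as the identity on the other qubits). -/
def czMatrix {Q : Type*} [DecidableEq Q] [Fintype Q] (T : Finset Q) :
    Matrix (Q → Bool) (Q → Bool) ℂ :=
  Matrix.diagonal (czPhase T)

/-- The matrix of a layer of `CZ` gates: the product of the diagonal matrices of its gates. -/
def czLayerMatrix {Q : Type*} [DecidableEq Q] [Fintype Q] (M : CZLayer Q) :
    Matrix (Q → Bool) (Q → Bool) ℂ :=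
  Matrix.diagonal fun x => ∏ T ∈ M.gates, czPhase T x

/-- `czLayerMatrix` is the product, in any order, of the matrices of the gates of the layer. -/
theorem czLayerMatrix_eq_prod {Q : Type*} [DecidableEq Q] [Fintype Q] (M : CZLayer Q) :
    czLayerMatrix M = (M.gates.toList.map czMatrix).prod := by
  have h : ∀ l : List (Finset Q), (l.map czMatrix).prod =
      Matrix.diagonal fun x : Q → Bool => (l.map fun T => czPhase T x).prod := by
    intro l
    induction l with
    | nil => simp
    | cons T l ih =>
      rw [List.map_cons, List.prod_cons, ih, czMatrix, Matrix.diagonal_mul_diagonal]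
      simp
  rw [h, czLayerMatrix]
  simp

namespace QACCircuit

variable {Q : Type*} {d : ℕ}

/-- The unitary `L_t M_t ⋯ L_1 M_1 L_0` of the first `t` layers of the circuit. -/
noncomputable def prefixUnitary [DecidableEq Q] [Fintype Q] (C : QACCircuit Q d) :
    Fin (d + 1) → Matrix (Q → Bool) (Q → Bool) ℂ :=
  Fin.induction (motive := fun _ => Matrix (Q → Bool) (Q → Bool) ℂ)
    (singleLayerMatrix (C.single 0))
    (fun k U => singleLayerMatrix (C.single k.succ) * czLayerMatrix (C.cz k) * U)

/-- The unitary `L_d M_d ⋯ L_1 M_1 L_0` implemented by the circuit. -/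
noncomputable def unitary [DecidableEq Q] [Fintype Q] (C : QACCircuit Q d) :
    Matrix (Q → Bool) (Q → Bool) ℂ :=
  C.prefixUnitary (Fin.last d)

/-- The qubits `a` and `b` are in the support of the same gate of layer `k`. Since a single-qubit
gate acts on every qubit, this holds whenever `a = b`. -/
def SameGate (C : QACCircuit Q d) (k : Fin d) (a b : Q) : Prop :=
  a = b ∨ ∃ T ∈ (C.cz k).gates, a ∈ T ∧ b ∈ T

/-- The forward light-cone of the qubit `i` in the circuit formed by the first `t` layers of `C`:
all qubits `j` that are reached from `i` by a path `p 0 = i, p 1, …, p t = j` in which, at each of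
the first `t` layers, consecutive qubits are in the support of the same gate. (The values of `p`
after `t` are irrelevant.) For `t = Fin.last d` it is the light-cone in the whole circuit. -/
def forwardLightCone (C : QACCircuit Q d) (t : Fin (d + 1)) (i : Q) : Set Q :=
  {j | ∃ p : Fin (d + 1) → Q, p 0 = i ∧ p t = j ∧
    ∀ k : Fin d, k.castSucc < t → C.SameGate k (p k.castSucc) (p k.succ)}

/-- The weight of a `CZ` gate with support `T` in layer `k`: the number of input qubits `i ∈ I`
whose forward light-cone, in the circuit formed by the layers before this gate, meets `T`. -/
noncomputable def weight (C : QACCircuit Q d) (I : Finset Q) (k : Fin d) (T : Finset Q) : ℕ :=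
  {i : Q | i ∈ I ∧ (C.forwardLightCone k.castSucc i ∩ (T : Set Q)).Nonempty}.ncard

/-- A circuit on `w` rows of `m` qubits each is a 2D-QAC circuit if every multi-qubit `CZ` gate acts
on an interval of consecutive qubits in one row or in one column. -/
def Is2D {w m : ℕ} (C : QACCircuit (Fin w × Fin m) d) : Prop :=
  ∀ k, ∀ T ∈ (C.cz k).gates,
    (∃ (r : Fin w) (c₁ c₂ : Fin m), T = {r} ×ˢ Finset.Icc c₁ c₂) ∨
    (∃ (r₁ r₂ : Fin w) (c : Fin m), T = Finset.Icc r₁ r₂ ×ˢ {c})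

end QACCircuit

/-- The state `|x⟩ ⊗ |a⟩`: the input qubits `I` are in the basis state `|x⟩` and the remaining
(ancilla) qubits are in the state `a`. -/
noncomputable def initialState {Q : Type*} [DecidableEq Q] [Fintype Q] (I : Finset Q)
    (a : EuclideanSpace ℂ ({q // q ∉ I} → Bool)) (x : {q // q ∈ I} → Bool) :
    (Q → Bool) → ℂ :=
  fun z => if (fun q : {q // q ∈ I} => z q) = x then a (fun q => z q) else 0

/-- The probability that measuring qubit `o` in the computational basis, after running `C` on
`|x⟩ ⊗ |a⟩`, gives the outcome `b`, i.e. `Pr[g_C(x) = b]`. -/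
noncomputable def QACCircuit.outputProb {Q : Type*} [DecidableEq Q] [Fintype Q] {d : ℕ}
    (C : QACCircuit Q d) (I : Finset Q) (a : EuclideanSpace ℂ ({q // q ∉ I} → Bool)) (o : Q)
    (x : {q // q ∈ I} → Bool) (b : Bool) : ℝ :=
  ∑ z : Q → Bool with z o = b, ‖(C.unitary.mulVec (initialState I a x)) z‖ ^ 2

/-- The parity `⊕ᵢ xᵢ` of a bit string. -/
def parity {ι : Type*} [Fintype ι] (x : ι → Bool) : Bool :=
  decide (Odd (Finset.univ.filter fun i => x i = true).card)

/-- The probability, over a uniformly random input `x` and the measurement, that the outcome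
`g_C(x)` equals the parity of `x`. -/
noncomputable def QACCircuit.paritySuccessProb {Q : Type*} [DecidableEq Q] [Fintype Q] {d : ℕ}
    (C : QACCircuit Q d) (I : Finset Q) (a : EuclideanSpace ℂ ({q // q ∉ I} → Bool)) (o : Q) : ℝ :=
  (∑ x : {q // q ∈ I} → Bool, C.outputProb I a o x (parity x)) / 2 ^ I.card

/-! A parity bit changes whenever a single input bit is flipped, so one input that cannot influence
the output already forces success probability 1/2: pairing `x` with its flip at that input, the two
outcome distributions agree while the parities are opposite, so the two success probabilities add up
to 1.

Such an input exists by counting. The inputs reaching `o` are those whose light-cone meets the last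
gate acting on `o`, so there are at most `s` of them (`ncard_inputs_le`), and the numerical
hypothesis gives `s < n`.

That inputs outside the backward cone have no influence is shown in the Heisenberg picture. With `F`
the flip of `i` and `U` the circuit, `U F = (U F U*) U`, and `U F U*` acts only on the forward cone
of `i` (`actsOn_conj_flipMatrix`). Locality is expressed as commutation with product operators
(`ActsOn`), which suffices because measurement projections are product operators and each CZ gate is
a combination of two of them. -/

open Matrix

/-! ### Product operators and locality -/

section Tensor

variable {Q : Type*} [Fintype Q]

/-- The tensor product of the single-qubit matrices `V q`. -/
def tensorMatrix (V : Q → Matrix Bool Bool ℂ) : Matrix (Q → Bool) (Q → Bool) ℂ :=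
  Matrix.of fun x y => ∏ q, V q (x q) (y q)

theorem tensorMatrix_apply (V : Q → Matrix Bool Bool ℂ) (x y : Q → Bool) :
    tensorMatrix V x y = ∏ q, V q (x q) (y q) := rfl

theorem star_tensorMatrix (V : Q → Matrix Bool Bool ℂ) :
    star (tensorMatrix V) = tensorMatrix (star V) := by
  ext x y
  simp [tensorMatrix_apply, Matrix.star_apply]

theorem singleLayerMatrix_eq_tensorMatrix (U : Q → Matrix.unitaryGroup Bool ℂ) :
    singleLayerMatrix U = tensorMatrix fun q => (U q : Matrix Bool Bool ℂ) := rfl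

theorem tensorMatrix_diagonal (D : Q → Bool → ℂ) :
    tensorMatrix (fun q => Matrix.diagonal (D q)) =
      Matrix.diagonal fun x : Q → Bool => ∏ q, D q (x q) := by
  ext x y
  rw [tensorMatrix_apply, Matrix.diagonal_apply]
  split_ifs with h
  · subst h
    simp
  · obtain ⟨q, hq⟩ := Function.ne_iff.mp h
    exact Finset.prod_eq_zero (Finset.mem_univ q) (Matrix.diagonal_apply_ne _ hq)

theorem tensorMatrix_one : tensorMatrix (1 : Q → Matrix Bool Bool ℂ) = 1 := by
  have h := tensorMatrix_diagonal (Q := Q) (fun _ _ => 1)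
  simp only [Finset.prod_const_one] at h
  rw [show (1 : Q → Matrix Bool Bool ℂ) = fun q => Matrix.diagonal fun _ => 1 by
    ext1 q; exact Matrix.diagonal_one.symm, h]
  exact Matrix.diagonal_one

variable [DecidableEq Q]

theorem tensorMatrix_mul (V W : Q → Matrix Bool Bool ℂ) :
    tensorMatrix (V * W) = tensorMatrix V * tensorMatrix W := by
  ext x y
  simp only [tensorMatrix_apply, Matrix.mul_apply, Pi.mul_apply]
  rw [Finset.prod_univ_sum, Fintype.piFinset_univ]
  simp only [Finset.prod_mul_distrib]

theorem tensorMatrix_mem_unitaryGroup {V : Q → Matrix Bool Bool ℂ}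
    (hV : ∀ q, V q ∈ Matrix.unitaryGroup Bool ℂ) :
    tensorMatrix V ∈ Matrix.unitaryGroup (Q → Bool) ℂ := by
  rw [Matrix.mem_unitaryGroup_iff, star_tensorMatrix, ← tensorMatrix_mul, ← tensorMatrix_one]
  congr 1
  ext1 q
  exact Matrix.mem_unitaryGroup_iff.mp (hV q)

theorem commute_tensorMatrix {V W : Q → Matrix Bool Bool ℂ} (h : Commute V W) :
    Commute (tensorMatrix V) (tensorMatrix W) := by
  rw [Commute, SemiconjBy, ← tensorMatrix_mul, ← tensorMatrix_mul, h.eq]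

/-- The projection of the qubits in `T` onto the basis state `|1⋯1⟩`, as a product operator. -/
def onesProj {Q : Type*} [DecidableEq Q] (T : Finset Q) (q : Q) : Matrix Bool Bool ℂ :=
  Matrix.diagonal fun b => if q ∈ T → b = true then 1 else 0

theorem onesProj_of_notMem {Q : Type*} [DecidableEq Q] {T : Finset Q} {q : Q} (h : q ∉ T) : onesProj T q = 1 := by
  simp [onesProj, h]

/-- A CZ gate is not a product operator, but this form reduces commuting with it to commuting with
one. -/
theorem czMatrix_eq (T : Finset Q) :
    czMatrix T = 1 - (2 : ℂ) • tensorMatrix (onesProj T) := by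
  have h : tensorMatrix (onesProj T) = Matrix.diagonal fun x : Q → Bool =>
      ∏ q, if q ∈ T → x q = true then (1 : ℂ) else 0 := tensorMatrix_diagonal _
  rw [h, czMatrix]
  ext x y
  rw [Matrix.sub_apply, Matrix.smul_apply, Matrix.one_apply, Matrix.diagonal_apply,
    Matrix.diagonal_apply]
  split_ifs with hxy
  · rw [Finset.prod_ite_zero]
    simp only [czPhase, Finset.mem_univ, forall_const, Finset.prod_const_one]
    split_ifs <;> norm_num
  · simp

theorem star_czMatrix (T : Finset Q) : star (czMatrix T) = czMatrix T := by
  rw [czMatrix, Matrix.star_eq_conjTranspose, Matrix.diagonal_conjTranspose]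
  congr 1
  ext1 x
  rw [Pi.star_apply, czPhase]
  split_ifs <;> simp

theorem czMatrix_mul_self (T : Finset Q) : czMatrix T * czMatrix T = 1 := by
  rw [czMatrix, Matrix.diagonal_mul_diagonal, ← Matrix.diagonal_one]
  congr 1
  ext1 x
  rw [czPhase]
  split_ifs <;> simp

theorem czMatrix_mem_unitaryGroup (T : Finset Q) :
    czMatrix T ∈ Matrix.unitaryGroup (Q → Bool) ℂ := by
  rw [Matrix.mem_unitaryGroup_iff, star_czMatrix, czMatrix_mul_self]

theorem czLayerMatrix_mem_unitaryGroup (M : CZLayer Q) :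
    czLayerMatrix M ∈ Matrix.unitaryGroup (Q → Bool) ℂ := by
  rw [czLayerMatrix_eq_prod]
  refine Submonoid.list_prod_mem _ fun A hA => ?_
  obtain ⟨T, -, rfl⟩ := List.mem_map.mp hA
  exact czMatrix_mem_unitaryGroup T

theorem singleLayerMatrix_mem_unitaryGroup (U : Q → Matrix.unitaryGroup Bool ℂ) :
    singleLayerMatrix U ∈ Matrix.unitaryGroup (Q → Bool) ℂ :=
  tensorMatrix_mem_unitaryGroup fun q => (U q).2

theorem commute_czMatrix {T : Finset Q} {A : Matrix (Q → Bool) (Q → Bool) ℂ}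
    (h : Commute A (tensorMatrix (onesProj T))) : Commute A (czMatrix T) := by
  rw [czMatrix_eq]
  exact (Commute.one_right A).sub_right (h.smul_right 2)

/-- The operator `A` acts only on the qubits in `S`: it commutes with every product operator that
is trivial on `S`. -/
def ActsOn (S : Set Q) (A : Matrix (Q → Bool) (Q → Bool) ℂ) : Prop :=
  ∀ V : Q → Matrix Bool Bool ℂ, (∀ q ∈ S, V q = 1) → Commute A (tensorMatrix V)

theorem ActsOn.mono {S S' : Set Q} (h : S ⊆ S') {A : Matrix (Q → Bool) (Q → Bool) ℂ}
    (hA : ActsOn S A) : ActsOn S' A :=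
  fun V hV => hA V fun q hq => hV q (h hq)

theorem ActsOn.conj_singleLayerMatrix {S : Set Q} {A : Matrix (Q → Bool) (Q → Bool) ℂ}
    (hA : ActsOn S A) (U : Q → Matrix.unitaryGroup Bool ℂ) :
    ActsOn S (singleLayerMatrix U * A * star (singleLayerMatrix U)) := by
  intro V hV
  have hL := singleLayerMatrix_mem_unitaryGroup U
  have h1 := Matrix.mem_unitaryGroup_iff.mp hL
  have h2 := Matrix.mem_unitaryGroup_iff'.mp hL
  -- Conjugating by `L` moves the question to `A` and `L* V L`, again a product operator, with
  -- factors `U_q* V_q U_q`, hence trivial on `S`.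
  have hc : Commute A (star (singleLayerMatrix U) * tensorMatrix V * singleLayerMatrix U) := by
    rw [singleLayerMatrix_eq_tensorMatrix, star_tensorMatrix, ← tensorMatrix_mul,
      ← tensorMatrix_mul]
    refine hA _ fun q hq => ?_
    simp only [Pi.mul_apply, Pi.star_apply, hV q hq, mul_one]
    exact Matrix.mem_unitaryGroup_iff'.mp (U q).2
  set L := singleLayerMatrix U
  set B := tensorMatrix V
  have hB : B = L * (star L * B * L) * star L := by
    rw [show L * (star L * B * L) * star L = (L * star L) * B * (L * star L) by noncomm_ring, h1]
    simp
  have key : ∀ X Y : Matrix (Q → Bool) (Q → Bool) ℂ,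
      L * X * star L * (L * Y * star L) = L * (X * Y) * star L := by
    intro X Y
    rw [show L * X * star L * (L * Y * star L) = L * X * (star L * L) * Y * star L by
      noncomm_ring, h2]
    noncomm_ring
  rw [Commute, SemiconjBy, hB, key, key, hc.eq]

/-- A gate inside `S` commutes with every product operator trivial on `S`; a gate disjoint from `S`
commutes with `A`, so the conjugation cancels. -/
theorem ActsOn.conj_czMatrix {S : Set Q} {A : Matrix (Q → Bool) (Q → Bool) ℂ}
    (hA : ActsOn S A) {T : Finset Q} (hT : (T : Set Q) ⊆ S ∨ Disjoint (T : Set Q) S) :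
    ActsOn S (czMatrix T * A * czMatrix T) := by
  rcases hT with hT | hT
  · intro V hV
    have hc : Commute (czMatrix T) (tensorMatrix V) := by
      refine (commute_czMatrix (commute_tensorMatrix ?_)).symm
      ext1 q
      by_cases hq : q ∈ T
      · simp [hV q (hT hq)]
      · simp [onesProj_of_notMem hq]
    exact (hc.mul_left (hA V hV)).mul_left hc
  · have hc : Commute A (czMatrix T) := commute_czMatrix <| hA _ fun q hq =>
      onesProj_of_notMem fun h => Set.disjoint_left.mp hT h hq
    rwa [← hc.eq, mul_assoc, czMatrix_mul_self, mul_one]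

theorem ActsOn.conj_czLayerMatrix {S : Set Q} {A : Matrix (Q → Bool) (Q → Bool) ℂ}
    (hA : ActsOn S A) {M : CZLayer Q}
    (hM : ∀ T ∈ M.gates, (T : Set Q) ⊆ S ∨ Disjoint (T : Set Q) S) :
    ActsOn S (czLayerMatrix M * A * star (czLayerMatrix M)) := by
  have h : ∀ l : List (Finset Q), (∀ T ∈ l, (T : Set Q) ⊆ S ∨ Disjoint (T : Set Q) S) →
      ActsOn S ((l.map czMatrix).prod * A * star (l.map czMatrix).prod) := by
    intro l
    induction l with
    | nil => simpa using hA
    | cons T l ih =>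
      intro hl
      have := (ih fun T' hT' => hl T' (List.mem_cons_of_mem _ hT')).conj_czMatrix
        (hl T List.mem_cons_self)
      rw [List.map_cons, List.prod_cons, star_mul, star_czMatrix]
      simpa only [mul_assoc] using this
  rw [czLayerMatrix_eq_prod]
  exact h _ fun T hT => hM T (Finset.mem_toList.mp hT)

/-- The Pauli matrix that exchanges `|0⟩` and `|1⟩`. -/
def pauliX : Matrix Bool Bool ℂ := Matrix.of fun a b => if b = !a then 1 else 0

theorem pauliX_mem_unitaryGroup : pauliX ∈ Matrix.unitaryGroup Bool ℂ := by
  rw [Matrix.mem_unitaryGroup_iff]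
  ext a b
  cases a <;> cases b <;> simp [pauliX, Matrix.mul_apply, Matrix.star_apply]

/-- The operator that flips the qubit `i`. -/
def flipMatrix (i : Q) : Matrix (Q → Bool) (Q → Bool) ℂ :=
  tensorMatrix (Pi.mulSingle i pauliX)

theorem flipMatrix_mem_unitaryGroup (i : Q) :
    flipMatrix i ∈ Matrix.unitaryGroup (Q → Bool) ℂ := by
  refine tensorMatrix_mem_unitaryGroup fun q => ?_
  by_cases h : q = i
  · subst h
    simpa using pauliX_mem_unitaryGroup
  · rw [Pi.mulSingle_eq_of_ne h]
    exact one_mem _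

theorem actsOn_flipMatrix (i : Q) : ActsOn {i} (flipMatrix i) := by
  intro V hV
  refine commute_tensorMatrix ?_
  ext1 q
  by_cases h : q = i
  · subst h
    simp [hV q rfl]
  · simp [Pi.mulSingle_eq_of_ne h]

theorem flipMatrix_apply (i : Q) (x y : Q → Bool) :
    flipMatrix i x y = if y = Function.update x i (!x i) then 1 else 0 := by
  have h : ∀ q, (Pi.mulSingle i pauliX : Q → Matrix Bool Bool ℂ) q (x q) (y q) =
      if y q = Function.update x i (!x i) q then 1 else 0 := by
    intro q
    by_cases hq : q = i
    · subst hq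
      simp [pauliX]
    · simp [hq, Matrix.one_apply, eq_comm]
  rw [flipMatrix, tensorMatrix_apply, Finset.prod_congr rfl fun q _ => h q, Finset.prod_ite_zero]
  simp [funext_iff]

theorem flipMatrix_mulVec (i : Q) (ψ : (Q → Bool) → ℂ) (x : Q → Bool) :
    (flipMatrix i *ᵥ ψ) x = ψ (Function.update x i (!x i)) := by
  simp [Matrix.mulVec, dotProduct, flipMatrix_apply]

end Tensor

/-! ### Measurement probabilities under unitaries -/

section NormSq

theorem sum_norm_sq_unitary_mulVec {ι : Type*} [Fintype ι] [DecidableEq ι] {W : Matrix ι ι ℂ}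
    (hW : W ∈ Matrix.unitaryGroup ι ℂ) (φ : ι → ℂ) :
    ∑ z, ‖(W *ᵥ φ) z‖ ^ 2 = ∑ z, ‖φ z‖ ^ 2 := by
  have h : ∀ φ : ι → ℂ, ((∑ z, ‖φ z‖ ^ 2 : ℝ) : ℂ) = star φ ⬝ᵥ φ := by
    intro φ
    simp [dotProduct, Complex.conj_mul']
  apply Complex.ofReal_injective
  rw [h, h, Matrix.star_mulVec, Matrix.dotProduct_mulVec, Matrix.vecMul_vecMul,
    ← Matrix.star_eq_conjTranspose, Matrix.mem_unitaryGroup_iff'.mp hW, Matrix.vecMul_one]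

variable {Q : Type*} [DecidableEq Q] [Fintype Q]

/-- A unitary that acts only on qubits other than `o` does not change the distribution of the
outcome of measuring `o`. -/
theorem ActsOn.sum_norm_sq_mulVec {S : Set Q} {W : Matrix (Q → Bool) (Q → Bool) ℂ}
    (hW : ActsOn S W) (hWu : W ∈ Matrix.unitaryGroup (Q → Bool) ℂ) {o : Q} (ho : o ∉ S)
    (φ : (Q → Bool) → ℂ) (b : Bool) :
    ∑ z : Q → Bool with z o = b, ‖(W *ᵥ φ) z‖ ^ 2 = ∑ z : Q → Bool with z o = b, ‖φ z‖ ^ 2 := by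
  set P : Matrix (Q → Bool) (Q → Bool) ℂ :=
    Matrix.diagonal fun z => if z o = b then 1 else 0 with hP
  -- The projection onto outcome `b` is a product operator whose only nontrivial factor is at `o ∉
  -- S`, so `W` commutes with it.
  have hPt : P = tensorMatrix fun q =>
      Matrix.diagonal fun c => if q = o → c = b then (1 : ℂ) else 0 := by
    rw [tensorMatrix_diagonal, hP]
    congr 1
    ext1 z
    rw [Finset.prod_ite_zero]
    simp
  have hc : Commute W P := by
    rw [hPt]
    refine hW _ fun q hq => ?_
    have : q ≠ o := fun h => ho (h ▸ hq)
    simp [this]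
  have hn : ∀ φ : (Q → Bool) → ℂ,
      ∑ z : Q → Bool with z o = b, ‖φ z‖ ^ 2 = ∑ z, ‖(P *ᵥ φ) z‖ ^ 2 := by
    intro φ
    rw [Finset.sum_filter]
    refine Finset.sum_congr rfl fun z _ => ?_
    rw [hP, Matrix.mulVec_diagonal]
    split_ifs <;> simp
  rw [hn, hn, Matrix.mulVec_mulVec, ← hc.eq, ← Matrix.mulVec_mulVec,
    sum_norm_sq_unitary_mulVec hWu]

end NormSq

/-! ### Light-cones and their effect on the output -/

namespace QACCircuit

variable {Q : Type*} {d : ℕ}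

theorem mem_forwardLightCone_zero {C : QACCircuit Q d} {i j : Q} :
    j ∈ C.forwardLightCone 0 i ↔ j = i := by
  constructor
  · rintro ⟨p, h0, h1, -⟩
    exact h1.symm.trans h0
  · rintro rfl
    exact ⟨fun _ => j, rfl, rfl, fun k hk => absurd hk (Fin.not_lt_zero _)⟩

theorem mem_forwardLightCone_succ {C : QACCircuit Q d} {k : Fin d} {i j : Q} :
    j ∈ C.forwardLightCone k.succ i ↔
      ∃ j' ∈ C.forwardLightCone k.castSucc i, C.SameGate k j' j := by
  constructor
  · rintro ⟨p, h0, h1, h⟩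
    refine ⟨p k.castSucc, ⟨p, h0, rfl, fun l hl => h l (hl.trans k.castSucc_lt_succ)⟩, ?_⟩
    rw [← h1]
    exact h k k.castSucc_lt_succ
  · rintro ⟨j', ⟨p, h0, h1, h⟩, hj⟩
    -- The path follows `p` up to the time before layer `k` and stays at `j` afterwards.
    refine ⟨fun l => if l ≤ k.castSucc then p l else j, ?_, ?_, fun l hl => ?_⟩
    · simpa using h0
    · simp [Fin.le_def]
    · rw [Fin.castSucc_lt_succ_iff] at hl
      beta_reduce
      rw [if_pos (Fin.castSucc_le_castSucc_iff.mpr hl)]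
      rcases hl.lt_or_eq with hlt | rfl
      · rw [if_pos (Fin.le_def.mpr (Nat.succ_le_of_lt hlt))]
        exact h l (by simpa using hlt)
      · rw [if_neg (by simp [Fin.le_def]), h1]
        exact hj

/-- A gate meeting the old cone is absorbed whole. Any other gate stays outside, since new qubits
enter only through gates that meet the old cone, and gates of a layer are disjoint. -/
theorem gate_subset_or_disjoint_forwardLightCone_succ (C : QACCircuit Q d) (k : Fin d) (i : Q)
    {T : Finset Q} (hT : T ∈ (C.cz k).gates) :
    (T : Set Q) ⊆ C.forwardLightCone k.succ i ∨
      Disjoint (T : Set Q) (C.forwardLightCone k.succ i) := by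
  by_cases h : ((T : Set Q) ∩ C.forwardLightCone k.castSucc i).Nonempty
  · obtain ⟨j', hj', hc⟩ := h
    exact .inl fun j hj => mem_forwardLightCone_succ.mpr ⟨j', hc, .inr ⟨T, hT, hj', hj⟩⟩
  · refine .inr (Set.disjoint_left.mpr fun j hj hjc => ?_)
    obtain ⟨j', hc, rfl | ⟨T', hT', hj', hj''⟩⟩ := mem_forwardLightCone_succ.mp hjc
    · exact h ⟨j', hj, hc⟩
    · obtain rfl : T = T' := (C.cz k).pairwiseDisjoint.eq hT hT' fun hd =>
        Finset.disjoint_left.mp hd hj hj''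
      exact h ⟨j', hj', hc⟩

/-- The number of inputs that influence a given qubit is bounded by the weight of the last gate
acting on it. -/
theorem ncard_inputs_le (C : QACCircuit Q d) (I : Finset Q) {s : ℕ} (hs : 1 ≤ s)
    (hweight : ∀ k, ∀ T ∈ (C.cz k).gates, C.weight I k T ≤ s) (t : Fin (d + 1)) (o : Q) :
    {i | i ∈ I ∧ o ∈ C.forwardLightCone t i}.ncard ≤ s := by
  induction t using Fin.induction with
  | zero =>
    refine (Set.ncard_le_ncard (t := {o}) ?_).trans (by simpa using hs)
    rintro i ⟨-, hi⟩
    exact (mem_forwardLightCone_zero.mp hi).symm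
  | succ k ih =>
    by_cases h : ∃ T ∈ (C.cz k).gates, o ∈ T
    · obtain ⟨T, hT, ho⟩ := h
      -- As `T` is the only gate of the layer containing `o`, an input reaching `o` after the layer
      -- already reached some qubit of `T` before it.
      refine (Set.ncard_le_ncard ?_ (I.finite_toSet.subset fun i hi => hi.1)).trans
        (hweight k T hT)
      rintro i ⟨hi, hc⟩
      refine ⟨hi, ?_⟩
      obtain ⟨j', hj, rfl | ⟨T', hT', hj', ho'⟩⟩ := mem_forwardLightCone_succ.mp hc
      · exact ⟨j', hj, ho⟩
      · obtain rfl : T = T' := (C.cz k).pairwiseDisjoint.eq hT hT' fun hd =>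
          Finset.disjoint_left.mp hd ho ho'
        exact ⟨j', hj, hj'⟩
    · refine (Set.ncard_le_ncard ?_ (I.finite_toSet.subset fun i hi => hi.1)).trans ih
      rintro i ⟨hi, hc⟩
      refine ⟨hi, ?_⟩
      obtain ⟨j', hj, rfl | ⟨T', hT', -, ho'⟩⟩ := mem_forwardLightCone_succ.mp hc
      · exact hj
      · exact absurd ⟨T', hT', ho'⟩ h

variable [DecidableEq Q] [Fintype Q]

theorem prefixUnitary_zero (C : QACCircuit Q d) :
    C.prefixUnitary 0 = singleLayerMatrix (C.single 0) := rfl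

theorem prefixUnitary_succ (C : QACCircuit Q d) (k : Fin d) :
    C.prefixUnitary k.succ =
      singleLayerMatrix (C.single k.succ) * czLayerMatrix (C.cz k) * C.prefixUnitary k.castSucc :=
  rfl

theorem prefixUnitary_mem_unitaryGroup (C : QACCircuit Q d) (t : Fin (d + 1)) :
    C.prefixUnitary t ∈ Matrix.unitaryGroup (Q → Bool) ℂ := by
  induction t using Fin.induction with
  | zero => exact singleLayerMatrix_mem_unitaryGroup _
  | succ k ih =>
    exact mul_mem (mul_mem (singleLayerMatrix_mem_unitaryGroup _)
      (czLayerMatrix_mem_unitaryGroup _)) ih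

/-- Flipping the qubit `i` before the circuit is the same as applying, after the circuit, the
conjugated flip, which acts only on the forward light-cone of `i`. -/
theorem actsOn_conj_flipMatrix (C : QACCircuit Q d) (i : Q) (t : Fin (d + 1)) :
    ActsOn (C.forwardLightCone t i)
      (C.prefixUnitary t * flipMatrix i * star (C.prefixUnitary t)) := by
  induction t using Fin.induction with
  | zero =>
    have : C.forwardLightCone 0 i = {i} := Set.ext fun j => mem_forwardLightCone_zero
    rw [this, prefixUnitary_zero]
    exact (actsOn_flipMatrix i).conj_singleLayerMatrix _
  | succ k ih =>
    -- The cone is enlarged before conjugating by the CZ layer, because only the new cone contains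
    -- or avoids each gate entirely.
    have hsub : C.forwardLightCone k.castSucc i ⊆ C.forwardLightCone k.succ i :=
      fun j hj => mem_forwardLightCone_succ.mpr ⟨j, hj, .inl rfl⟩
    have := ((ih.mono hsub).conj_czLayerMatrix fun T hT =>
      C.gate_subset_or_disjoint_forwardLightCone_succ k i hT).conj_singleLayerMatrix
        (C.single k.succ)
    rw [prefixUnitary_succ]
    simpa only [star_mul, mul_assoc] using this

/-- An input outside the backward light-cone of the output qubit does not influence the output. -/
theorem outputProb_update (C : QACCircuit Q d) (I : Finset Q)
    (a : EuclideanSpace ℂ ({q // q ∉ I} → Bool)) {o : Q} (i : {q // q ∈ I})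
    (ho : o ∉ C.forwardLightCone (Fin.last d) i) (x : {q // q ∈ I} → Bool) (b : Bool) :
    C.outputProb I a o (Function.update x i (!x i)) b = C.outputProb I a o x b := by
  have hstate : initialState I a (Function.update x i (!x i)) =
      flipMatrix (i : Q) *ᵥ initialState I a x := by
    ext z
    rw [flipMatrix_mulVec, initialState, initialState]
    have h1 : (fun q : {q // q ∉ I} => Function.update z (i : Q) (!z i) q) = fun q : {q // q ∉ I} => z q := by
      ext1 q
      exact Function.update_of_ne (fun h : (q : Q) = i => q.2 (h ▸ i.2)) _ _
    have h2 : (fun q : {q // q ∈ I} => Function.update z (i : Q) (!z i) q) =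
        Function.update (fun q : {q // q ∈ I} => z q) i (!z i) := by
      ext1 q
      by_cases hq : q = i
      · subst hq
        simp
      · rw [Function.update_of_ne hq, Function.update_of_ne (Subtype.coe_injective.ne hq)]
    rw [h1, h2]
    congr 1
    -- The flip is an involution, so it may be moved from the input string to the restriction of
    -- `z`.
    rw [eq_iff_iff, Function.eq_update_iff, Function.update_eq_iff]
    refine and_congr ?_ (forall₂_congr fun _ _ => Iff.rfl)
    cases z i <;> cases x i <;> simp
  have hU := C.prefixUnitary_mem_unitaryGroup (Fin.last d)
  have hconj : C.unitary * flipMatrix (i : Q) =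
      C.unitary * flipMatrix (i : Q) * star C.unitary * C.unitary := by
    rw [mul_assoc _ (star C.unitary), unitary, Matrix.mem_unitaryGroup_iff'.mp hU, mul_one]
  rw [outputProb, outputProb, hstate, Matrix.mulVec_mulVec, hconj, ← Matrix.mulVec_mulVec]
  exact (C.actsOn_conj_flipMatrix i (Fin.last d)).sum_norm_sq_mulVec
    (mul_mem (mul_mem hU (flipMatrix_mem_unitaryGroup _)) (Unitary.star_mem hU)) ho _ b

theorem outputProb_add_outputProb_not (C : QACCircuit Q d) (I : Finset Q)
    {a : EuclideanSpace ℂ ({q // q ∉ I} → Bool)} (ha : ‖a‖ = 1) (o : Q)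
    (x : {q // q ∈ I} → Bool) (b : Bool) :
    C.outputProb I a o x b + C.outputProb I a o x (!b) = 1 := by
  have hstate : ∑ z, ‖initialState I a x z‖ ^ 2 = 1 := by
    -- Splitting `z` into input and ancilla parts, only the input part `x` contributes, leaving `‖a‖
    -- ^ 2`.
    rw [← Equiv.sum_comp (Equiv.piEquivPiSubtypeProd (· ∈ I) fun _ => Bool).symm,
      Fintype.sum_prod_type, Finset.sum_eq_single x]
    · have h : ‖a‖ ^ 2 = 1 := by rw [ha, one_pow]
      rw [EuclideanSpace.norm_sq_eq] at h
      rw [← h]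
      refine Finset.sum_congr rfl fun y _ => ?_
      have hy : (fun q : {q // q ∉ I} => if h : (q : Q) ∈ I then x ⟨q, h⟩ else y q) = y :=
        funext fun q => dif_neg q.2
      simp [initialState, Equiv.piEquivPiSubtypeProd, hy]
    · intro y _ hy
      refine Finset.sum_eq_zero fun y' _ => ?_
      simp [initialState, Equiv.piEquivPiSubtypeProd, hy]
    · simp
  have hflip : ∀ z : Q → Bool, z o = !b ↔ ¬ z o = b := fun z => by
    cases z o <;> cases b <;> simp
  rw [outputProb, outputProb, Finset.filter_congr fun z _ => hflip z,
    Finset.sum_filter_add_sum_filter_not, unitary,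
    sum_norm_sq_unitary_mulVec (C.prefixUnitary_mem_unitaryGroup (Fin.last d)), hstate]

end QACCircuit

/-! ### Parity and the conclusion -/

theorem parity_update_not {ι : Type*} [Fintype ι] [DecidableEq ι] (x : ι → Bool) (i : ι) :
    parity (Function.update x i (!x i)) = !parity x := by
  have h : ∀ y : ι → Bool, (Finset.univ.filter fun j => y j = true).card =
      (y i).toNat + ((Finset.univ.erase i).filter fun j => y j = true).card := by
    intro y
    rw [Finset.card_filter, Finset.card_filter, ← Finset.add_sum_erase _ _ (Finset.mem_univ i)]
    cases y i <;> simp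
  have h2 : ((Finset.univ.erase i).filter fun j => Function.update x i (!x i) j = true) =
      (Finset.univ.erase i).filter fun j => x j = true :=
    Finset.filter_congr fun j hj => by rw [Function.update_of_ne (Finset.ne_of_mem_erase hj)]
  rw [parity, parity, h, h x, h2, Function.update_self]
  cases x i <;> simp [add_comm 1, Nat.odd_add_one, -Nat.not_odd_iff_even]

/-- If the output qubit is outside the forward light-cone of some input, the circuit is
uncorrelated with the parity. -/
theorem QACCircuit.paritySuccessProb_eq_half {Q : Type*} [DecidableEq Q] [Fintype Q] {d : ℕ}
    (C : QACCircuit Q d) (I : Finset Q) {a : EuclideanSpace ℂ ({q // q ∉ I} → Bool)}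
    (ha : ‖a‖ = 1) {o i : Q} (hi : i ∈ I) (ho : o ∉ C.forwardLightCone (Fin.last d) i) :
    C.paritySuccessProb I a o = 1 / 2 := by
  let e : Equiv.Perm ({q // q ∈ I} → Bool) := Function.Involutive.toPerm
    (fun x => Function.update x ⟨i, hi⟩ (!x ⟨i, hi⟩)) fun x => by simp
  set F : ({q // q ∈ I} → Bool) → ℝ := fun x => C.outputProb I a o x (parity x) with hF
  have h : ∀ x, F x + F (e x) = 1 := by
    intro x
    have he : e x = Function.update x ⟨i, hi⟩ (!x ⟨i, hi⟩) := rfl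
    simp only [hF]
    rw [he, parity_update_not, C.outputProb_update I a ⟨i, hi⟩ ho,
      C.outputProb_add_outputProb_not I ha]
  have hsum : ∑ x, F x + ∑ x, F x = 2 ^ I.card := by
    -- Reindexing one copy of the sum by the flip `e` pairs the terms so that each pair contributes
    -- 1.
    nth_rw 2 [← Equiv.sum_comp e F]
    rw [← Finset.sum_add_distrib, Finset.sum_congr rfl fun x _ => h x]
    simp
  rw [paritySuccessProb, div_eq_iff (by positivity)]
  linarith

theorem mainTheorem11 (n w m s d : ℕ) (hn : 1 ≤ n) (hw : 1 ≤ w) (hs : 3 ≤ s) (hd : 1 ≤ d)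
    (C : QACCircuit (Fin w × Fin m) d) (hC : C.Is2D)
    (I : Finset (Fin w × Fin m)) (hI : I.card = n)
    (a : EuclideanSpace ℂ ({q // q ∉ I} → Bool)) (ha : ‖a‖ = 1)
    (o : Fin w × Fin m)
    (hweight : ∀ k, ∀ T ∈ (C.cz k).gates, C.weight I k T ≤ s)
    (hbound : (2 * (s : ℝ)) ^ w * (2 * (w : ℝ) + 1) ^ (w * (w - 1) / 2)
      < (n : ℝ) ^ (1 / (d : ℝ))) :
    C.paritySuccessProb I a o = 1 / 2 := by
  -- `s ≤ (2s)^w` because `w ≥ 1`, the second factor is at least 1, and `n^(1/d) ≤ n` because `d ≥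
  -- 1`.
  have hsn : s < n := by
    have hs' : (3 : ℝ) ≤ s := by exact_mod_cast hs
    have h1 : (s : ℝ) ≤ (2 * (s : ℝ)) ^ w :=
      (by linarith : (s : ℝ) ≤ 2 * s).trans (le_self_pow₀ (by linarith) (by omega))
    have h2 : (1 : ℝ) ≤ (2 * (w : ℝ) + 1) ^ (w * (w - 1) / 2) :=
      one_le_pow₀ (by linarith [(Nat.cast_nonneg w : (0 : ℝ) ≤ w)])
    have h3 : (n : ℝ) ^ (1 / (d : ℝ)) ≤ n := by
      have hd' : (1 : ℝ) ≤ d := by exact_mod_cast hd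
      refine (Real.rpow_le_rpow_of_exponent_le (by exact_mod_cast hn)
        ((div_le_one (by linarith)).mpr hd')).trans_eq (Real.rpow_one _)
    have h4 : (s : ℝ) < n :=
      (h1.trans (le_mul_of_one_le_right (by positivity) h2)).trans_lt (hbound.trans_le h3)
    exact_mod_cast h4
  obtain ⟨i, hi, ho⟩ : ∃ i ∈ I, o ∉ C.forwardLightCone (Fin.last d) i := by
    by_contra! h
    have hle := C.ncard_inputs_le I (by omega : 1 ≤ s) hweight (Fin.last d) o
    rw [show {i | i ∈ I ∧ o ∈ C.forwardLightCone (Fin.last d) i} = (I : Set _) from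
      Set.ext fun i => ⟨fun hi => hi.1, fun hi => ⟨hi, h i hi⟩⟩, Set.ncard_coe_finset] at hle
    omega
  exact C.paritySuccessProb_eq_half I ha hi ho
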